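/- **Theorem 4.7.** Let $(\mathcal C,\mathbb E,\mathfrak s)$ be an extriangulated category (in the sense of Nakaoka and Palu) with enough projectives and enough injectives, and let $n\ge 1$ be an integer. All subcategories are full, additive and closed under isomorphisms. *Conventions.* A conflation is a sequence $A\to B\to C$ that realizes some extension in $\mathbb E(C,A)$. The higher extension groups are $\mathbb E^{i+1}(X,Y)=\mathbb E(\Omega^iX,Y)$ for $i\ge 0$, where $\Omega X$ denotes a syzygy of $X$, that is, there is a conflation $\Omega X\to P\to X$ with $P$ projective. For a subcategory $\mathcal T$ put $$\mathcal T^{\perp}=\{Y\mid \mathbb E^i(T,Y)=0\ \ \forall i\ge 1,\ T\in\mathcal T\},\qquad {}^{\perp}\mathcal T=\{Y\mid \mathbb E^i(Y,T)=0\ \ \forall i\ge 1,\ T\in\mathcal T\}.$$ An $\mathbb E$-triangle sequence $A'\to X_n\to\cdots\to X_1\to A$ is one spliced from conflations $K_i\to X_i\to K_{i-1}$ $(1\le i\le n)$ with $K_0=A$ and $K_n=A'$. Let $\mathrm{Pres}^n(\mathcal T)$ consist of all $A$ for which there is an $\mathbb E$-triangle sequence $A'\to T_n\to\cdots\to T_1\to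 A$ with all $T_i\in\mathcal T$, and $\mathrm{Copres}^n(\mathcal T)$ of all $A$ for which there is an $\mathbb E$-triangle sequence $A\to T_1\to\cdots\to T_n\to A'$ with all $T_i\in\mathcal T$. The projective dimension $\mathrm{pd}(A)$ is the least $m$ for which there is an $\mathbb E$-triangle sequence $P_m\to P_{m-1}\to\cdots\to P_0\to A$ with all $P_j$ projective ($\infty$ if there is none); $\mathrm{pd}(\mathcal T)$ is the supremum of $\mathrm{pd}(T)$ over $T\in\mathcal T$; the injective dimension $\mathrm{id}$ is defined dually. A subcategory $\mathcal X$ is a generator for $\mathcal Y$ if $\mathcal X\subseteq\mathcal Y$ and for each $Y\in\mathcal Y$ there is a conflation $Y'\to X\to Y$ with $X\in\mathcal X$ and $Y'\in\mathcal Y$; it is a cogenerator for $\mathcal Y$ if $\mathcal X\subseteq\mathcal Y$ and for each $Y\in\mathcal Y$ there is a conflation $Y\to X\to Y'$ with $X\in\mathcal X$ and $Y'\in\mathcal Y$. A right $\mathcal T$-approximation of $B$ is a morphism $T\to B$ with $T\in\mathcal T$ through which each morphism $T'\to B$ with $T'\in\mathcal T$ factors; left $\mathcal T$-approximations are defined dually.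 A subcategory $\mathcal T$ closed under direct summands is *tilting* (of projective dimension $n$) if $\mathrm{pd}(\mathcal T)\le n$ and $\mathcal T$ is a generator for $\mathcal T^{\perp}$; it is *cotilting* (of injective dimension $n$) if $\mathrm{id}(\mathcal T)\le n$ and $\mathcal T$ is a cogenerator for ${}^{\perp}\mathcal T$. (i) Let $\mathcal T$ be a subcategory of $\mathcal C$ that is closed under direct summands and such that every object of $\mathcal T^{\perp}$ has a right $\mathcal T$-approximation. Then $\mathcal T$ is a tilting subcategory (of projective dimension $n$) if and only if $\mathrm{Pres}^n(\mathcal T)=\mathcal T^{\perp}$. (ii) Let $\mathcal T$ be a subcategory of $\mathcal C$ that is closed under direct summands and such that every object of ${}^{\perp}\mathcal T$ has a left $\mathcal T$-approximation. Then $\mathcal T$ is a cotilting subcategory (of injective dimension $n$) if and only if $\mathrm{Copres}^n(\mathcal T)={}^{\perp}\mathcal T$. -/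

import Mathlib

open CategoryTheory CategoryTheory.Limits Opposite

universe w v u

namespace Extri

section Extensions

variable {C : Type u} [Category.{v} C]

/-- The group `𝔼(X, A)` of extensions attached to a bifunctor `𝔼 : Cᵒᵖ × C → Ab`
(given in curried form). -/
abbrev ExtOf (E : Cᵒᵖ ⥤ C ⥤ AddCommGrpCat.{w}) (X A : C) : Type w :=
  ((E.obj (op X)).obj A : AddCommGrpCat.{w})

/-- `a_* δ`, for `δ ∈ 𝔼(X, A)` and `a : A ⟶ A'`. -/
def push (E : Cᵒᵖ ⥤ C ⥤ AddCommGrpCat.{w}) {X A A' : C} (a : A ⟶ A') (δ : ExtOf E X A) :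
    ExtOf E X A' :=
  ((E.obj (op X)).map a).hom δ

/-- `c^* δ`, for `δ ∈ 𝔼(X, A)` and `c : X' ⟶ X`. -/
def pull (E : Cᵒᵖ ⥤ C ⥤ AddCommGrpCat.{w}) {X X' A : C} (c : X' ⟶ X) (δ : ExtOf E X A) :
    ExtOf E X' A :=
  ((E.map c.op).app A).hom δ

/-- A sequence of morphisms `A ⟶ B ⟶ X` with fixed ends `A` and `X`. -/
structure Seq (A X : C) where
  mid : C
  fst : A ⟶ mid
  snd : mid ⟶ X

/-- Two sequences with the same ends are equivalent if an isomorphism of their middle terms is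
compatible with their morphisms. -/
def seqSetoid (A X : C) : Setoid (Seq A X) where
  r p q := ∃ b : p.mid ≅ q.mid, p.fst ≫ b.hom = q.fst ∧ b.hom ≫ q.snd = p.snd
  iseqv :=
    { refl := fun p => ⟨Iso.refl _, by simp, by simp⟩
      symm := by
        rintro p q ⟨b, h₁, h₂⟩
        exact ⟨b.symm, by simp [← h₁], by simp [← h₂]⟩
      trans := by
        rintro p q r ⟨b, h₁, h₂⟩ ⟨b', h₃, h₄⟩
        exact ⟨b ≪≫ b', by simp [← h₃, ← h₁], by simp [h₄, h₂]⟩ }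

/-- Equivalence classes of sequences `A ⟶ B ⟶ X`. -/
def SeqClass (A X : C) : Type (max u v) := Quotient (seqSetoid A X)

/-- The class `[A ⟶ B ⟶ X]`. -/
def seqClass {A B X : C} (x : A ⟶ B) (y : B ⟶ X) : SeqClass A X :=
  Quotient.mk (seqSetoid A X) ⟨B, x, y⟩

end Extensions

/-- An external triangulation `(𝔼, 𝔰)` of an additive category `C`; together with it `C` is an
extriangulated category in the sense of Nakaoka and Palu. -/
structure ExtriangulatedStructure (C : Type u) [Category.{v} C] [Preadditive C]
    [HasZeroObject C] [HasBinaryBiproducts C] where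
  /-- The bifunctor `𝔼 : Cᵒᵖ × C → Ab`. -/
  E : Cᵒᵖ ⥤ C ⥤ AddCommGrpCat.{w}
  /-- (ET1) additivity in the second variable. -/
  push_add : ∀ {X A A' : C} (a a' : A ⟶ A') (δ : ExtOf E X A),
    push E (a + a') δ = push E a δ + push E a' δ
  /-- (ET1) additivity in the first variable. -/
  pull_add : ∀ {X X' A : C} (c c' : X' ⟶ X) (δ : ExtOf E X A),
    pull E (c + c') δ = pull E c δ + pull E c' δ
  /-- The assignment of an equivalence class of sequences to each extension. -/
  s : ∀ {X A : C}, ExtOf E X A → SeqClass A X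
  /-- (ET2) `𝔰` is a realization: each morphism of extensions is realized. -/
  realization : ∀ {A B X A' B' X' : C} (x : A ⟶ B) (y : B ⟶ X) (x' : A' ⟶ B') (y' : B' ⟶ X')
    (δ : ExtOf E X A) (δ' : ExtOf E X' A'),
    s δ = seqClass x y → s δ' = seqClass x' y' →
    ∀ (a : A ⟶ A') (c : X ⟶ X'), push E a δ = pull E c δ' →
      ∃ b : B ⟶ B', x ≫ b = a ≫ x' ∧ y ≫ c = b ≫ y'
  /-- (ET2) the split extension is realized by the split sequence. -/
  s_zero : ∀ A X : C,
    s (0 : ExtOf E X A) = seqClass (biprod.inl : A ⟶ A ⊞ X) (biprod.snd : A ⊞ X ⟶ X)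
  /-- (ET2) `𝔰 (δ ⊕ δ') = 𝔰 δ ⊕ 𝔰 δ'`, where `δ ⊕ δ'` is the element of `𝔼(X ⊞ X', A ⊞ A')` with
  components `δ, 0, 0, δ'`. -/
  s_sum : ∀ {A B X A' B' X' : C} (x : A ⟶ B) (y : B ⟶ X) (x' : A' ⟶ B') (y' : B' ⟶ X')
    (δ : ExtOf E X A) (δ' : ExtOf E X' A'),
    s δ = seqClass x y → s δ' = seqClass x' y' →
      s (push E (biprod.inl : A ⟶ A ⊞ A') (pull E (biprod.fst : X ⊞ X' ⟶ X) δ) +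
          push E (biprod.inr : A' ⟶ A ⊞ A') (pull E (biprod.snd : X ⊞ X' ⟶ X') δ')) =
        seqClass (biprod.map x x') (biprod.map y y')
  /-- (ET3) -/
  et3 : ∀ {A B X A' B' X' : C} (x : A ⟶ B) (y : B ⟶ X) (x' : A' ⟶ B') (y' : B' ⟶ X')
    (δ : ExtOf E X A) (δ' : ExtOf E X' A'),
    s δ = seqClass x y → s δ' = seqClass x' y' →
    ∀ (a : A ⟶ A') (b : B ⟶ B'), x ≫ b = a ≫ x' →
      ∃ c : X ⟶ X', y ≫ c = b ≫ y' ∧ push E a δ = pull E c δ'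
  /-- (ET3)ᵒᵖ -/
  et3_op : ∀ {A B X A' B' X' : C} (x : A ⟶ B) (y : B ⟶ X) (x' : A' ⟶ B') (y' : B' ⟶ X')
    (δ : ExtOf E X A) (δ' : ExtOf E X' A'),
    s δ = seqClass x y → s δ' = seqClass x' y' →
    ∀ (b : B ⟶ B') (c : X ⟶ X'), y ≫ c = b ≫ y' →
      ∃ a : A ⟶ A', x ≫ b = a ≫ x' ∧ push E a δ = pull E c δ'
  /-- (ET4) -/
  et4 : ∀ {A B D M F : C} (f : A ⟶ B) (f' : B ⟶ D) (g : B ⟶ M) (g' : M ⟶ F)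
    (δ : ExtOf E D A) (δ' : ExtOf E F B),
    s δ = seqClass f f' → s δ' = seqClass g g' →
      ∃ (N : C) (h : A ⟶ M) (h' : M ⟶ N) (d : D ⟶ N) (e : N ⟶ F) (δ'' : ExtOf E N A),
        f ≫ g = h ∧ f' ≫ d = g ≫ h' ∧ h' ≫ e = g' ∧
        s δ'' = seqClass h h' ∧
        s (push E f' δ') = seqClass d e ∧
        pull E d δ'' = δ ∧
        push E f δ'' = pull E e δ'
  /-- (ET4)ᵒᵖ -/
  et4_op : ∀ {A B D M F : C} (f' : D ⟶ A) (f : A ⟶ B) (g' : F ⟶ B) (g : B ⟶ M)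
    (δ : ExtOf E B D) (δ' : ExtOf E M F),
    s δ = seqClass f' f → s δ' = seqClass g' g →
      ∃ (N : C) (d : D ⟶ N) (e : N ⟶ F) (h' : N ⟶ A) (h : A ⟶ M) (δ'' : ExtOf E M N),
        d ≫ h' = f' ∧ e ≫ g' = h' ≫ f ∧ f ≫ g = h ∧
        s δ'' = seqClass h' h ∧
        s (pull E g' δ) = seqClass d e ∧
        push E e δ'' = δ' ∧
        push E d δ = pull E g δ''

section Notions

variable {C : Type u} [Category.{v} C] [Preadditive C] [HasZeroObject C] [HasBinaryBiproducts C]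
  (S : ExtriangulatedStructure.{w} C)

/-- `A ⟶ B ⟶ X` is a conflation: it realizes some extension `δ ∈ 𝔼(X, A)`. -/
def IsConflation {A B X : C} (x : A ⟶ B) (y : B ⟶ X) : Prop :=
  ∃ δ : ExtOf S.E X A, S.s δ = seqClass x y

/-- Projective objects of an extriangulated category. -/
def IsProj : ObjectProperty C := fun P =>
  ∀ ⦃A B X : C⦄ (x : A ⟶ B) (y : B ⟶ X), IsConflation S x y →
    ∀ c : P ⟶ X, ∃ b : P ⟶ B, b ≫ y = c

/-- Injective objects of an extriangulated category. -/
def IsInj : ObjectProperty C := fun I =>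
  ∀ ⦃A B X : C⦄ (x : A ⟶ B) (y : B ⟶ X), IsConflation S x y →
    ∀ a : A ⟶ I, ∃ b : B ⟶ I, x ≫ b = a

/-- Each object is the end of a conflation `K ⟶ P ⟶ X` with `P` projective. -/
class EnoughProj : Prop where
  exists_conflation : ∀ X : C, ∃ (K P : C) (x : K ⟶ P) (y : P ⟶ X),
    IsProj S P ∧ IsConflation S x y

/-- Each object is the start of a conflation `A ⟶ I ⟶ L` with `I` injective. -/
class EnoughInj : Prop where
  exists_conflation : ∀ A : C, ∃ (I L : C) (x : A ⟶ I) (y : I ⟶ L),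
    IsInj S I ∧ IsConflation S x y

/-- A syzygy `Ω X` of `X`. -/
noncomputable def syzygy [EnoughProj S] (X : C) : C :=
  (EnoughProj.exists_conflation (S := S) X).choose

/-- The higher extension group `𝔼^{i+1}(X, Y) = 𝔼(Ω^i X, Y)`; in particular `i = 0` gives
`𝔼(X, Y)`. -/
abbrev HigherExt [EnoughProj S] (i : ℕ) (X Y : C) : Type w :=
  ExtOf S.E ((syzygy S)^[i] X) Y

/-- `𝒯^⊥`: the objects `Y` with `𝔼^i(T, Y) = 0` for all `i ≥ 1` and all `T ∈ 𝒯`. -/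
def rightPerp [EnoughProj S] (𝒯 : ObjectProperty C) : ObjectProperty C := fun Y =>
  ∀ (i : ℕ) (T : C), 𝒯 T → ∀ δ : HigherExt S i T Y, δ = 0

/-- `^⊥𝒯`: the objects `Y` with `𝔼^i(Y, T) = 0` for all `i ≥ 1` and all `T ∈ 𝒯`. -/
def leftPerp [EnoughProj S] (𝒯 : ObjectProperty C) : ObjectProperty C := fun Y =>
  ∀ (i : ℕ) (T : C), 𝒯 T → ∀ δ : HigherExt S i Y T, δ = 0

/-- `TriangleSeq S 𝒳 n A' A`: there is an `𝔼`-triangle sequence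
`A' ⟶ X_n ⟶ ⋯ ⟶ X_1 ⟶ A` with all `X_i ∈ 𝒳`, that is, there are conflations
`K_i ⟶ X_i ⟶ K_{i-1}` for `1 ≤ i ≤ n`, with `K_0 = A` and `K_n = A'`. -/
inductive TriangleSeq (𝒳 : ObjectProperty C) : ℕ → C → C → Prop
  | nil (A : C) : TriangleSeq 𝒳 0 A A
  | cons {n : ℕ} {A' K X A : C} (x : K ⟶ X) (y : X ⟶ A) (hX : 𝒳 X)
      (hxy : IsConflation S x y) (h : TriangleSeq 𝒳 n A' K) : TriangleSeq 𝒳 (n + 1) A' A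

/-- `Pres^n(𝒯)`: there is an `𝔼`-triangle sequence `A' ⟶ T_n ⟶ ⋯ ⟶ T_1 ⟶ A`. -/
def Pres (n : ℕ) (𝒯 : ObjectProperty C) : ObjectProperty C := fun A =>
  ∃ A' : C, TriangleSeq S 𝒯 n A' A

/-- `Copres^n(𝒯)`: there is an `𝔼`-triangle sequence `A ⟶ T_1 ⟶ ⋯ ⟶ T_n ⟶ A'`. -/
def Copres (n : ℕ) (𝒯 : ObjectProperty C) : ObjectProperty C := fun A =>
  ∃ A' : C, TriangleSeq S 𝒯 n A A'

/-- `A` has a projective resolution `P_n ⟶ ⋯ ⟶ P_0 ⟶ A` of length `n`. -/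
def HasProjResolution (n : ℕ) (A : C) : Prop :=
  ∃ P : C, IsProj S P ∧ TriangleSeq S (IsProj S) n P A

/-- `A` has an injective resolution `A ⟶ I_0 ⟶ ⋯ ⟶ I_n` of length `n`. -/
def HasInjResolution (n : ℕ) (A : C) : Prop :=
  ∃ I : C, IsInj S I ∧ TriangleSeq S (IsInj S) n A I

/-- The projective dimension of an object: the least length of a projective resolution, and `∞`
if there is no finite one. -/
noncomputable def projDim (A : C) : ℕ∞ := ⨅ (n : ℕ) (_ : HasProjResolution S n A), (n : ℕ∞)

/-- The injective dimension of an object. -/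
noncomputable def injDim (A : C) : ℕ∞ := ⨅ (n : ℕ) (_ : HasInjResolution S n A), (n : ℕ∞)

/-- `𝒳` is a generator for `𝒴`: `𝒳 ⊆ 𝒴` and each `Y ∈ 𝒴` is the end of a conflation
`Y' ⟶ X ⟶ Y` with `X ∈ 𝒳` and `Y' ∈ 𝒴`. -/
def IsGenerator (𝒳 𝒴 : ObjectProperty C) : Prop :=
  (∀ X, 𝒳 X → 𝒴 X) ∧
    ∀ Y, 𝒴 Y → ∃ (Y' X : C) (x : Y' ⟶ X) (y : X ⟶ Y), 𝒴 Y' ∧ 𝒳 X ∧ IsConflation S x y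

/-- `𝒳` is a cogenerator for `𝒴`: `𝒳 ⊆ 𝒴` and each `Y ∈ 𝒴` is the start of a conflation
`Y ⟶ X ⟶ Y'` with `X ∈ 𝒳` and `Y' ∈ 𝒴`. -/
def IsCogenerator (𝒳 𝒴 : ObjectProperty C) : Prop :=
  (∀ X, 𝒳 X → 𝒴 X) ∧
    ∀ Y, 𝒴 Y → ∃ (X Y' : C) (x : Y ⟶ X) (y : X ⟶ Y'), 𝒳 X ∧ 𝒴 Y' ∧ IsConflation S x y

/-- A (full) additive subcategory closed under isomorphisms. -/
structure IsAdditiveSubcategory (𝒯 : ObjectProperty C) : Prop where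
  iso : ∀ {A B : C}, (A ≅ B) → 𝒯 A → 𝒯 B
  zero : ∀ Z : C, IsZero Z → 𝒯 Z
  biprod : ∀ A B : C, 𝒯 A → 𝒯 B → 𝒯 (A ⊞ B)

/-- `𝒯` is closed under direct summands. -/
def ClosedUnderSummands (𝒯 : ObjectProperty C) : Prop :=
  ∀ A B : C, 𝒯 (A ⊞ B) → 𝒯 A ∧ 𝒯 B

/-- `B` has a right `𝒯`-approximation. -/
def HasRightApprox (𝒯 : ObjectProperty C) (B : C) : Prop :=
  ∃ (X : C) (f : X ⟶ B), 𝒯 X ∧ ∀ X' : C, 𝒯 X' → ∀ g : X' ⟶ B, ∃ h : X' ⟶ X, h ≫ f = g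

/-- `B` has a left `𝒯`-approximation. -/
def HasLeftApprox (𝒯 : ObjectProperty C) (B : C) : Prop :=
  ∃ (Y : C) (f : B ⟶ Y), 𝒯 Y ∧ ∀ Y' : C, 𝒯 Y' → ∀ g : B ⟶ Y', ∃ h : Y ⟶ Y', f ≫ h = g

/-- Tilting subcategories of projective dimension at most `n`. -/
structure IsTilting [EnoughProj S] (n : ℕ) (𝒯 : ObjectProperty C) : Prop where
  additive : IsAdditiveSubcategory 𝒯
  summands : ClosedUnderSummands 𝒯
  pd_le : (⨆ (T : C) (_ : 𝒯 T), projDim S T) ≤ n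
  generator : IsGenerator S 𝒯 (rightPerp S 𝒯)

/-- Cotilting subcategories of injective dimension at most `n`. -/
structure IsCotilting [EnoughProj S] (n : ℕ) (𝒯 : ObjectProperty C) : Prop where
  additive : IsAdditiveSubcategory 𝒯
  summands : ClosedUnderSummands 𝒯
  id_le : (⨆ (T : C) (_ : 𝒯 T), injDim S T) ≤ n
  cogenerator : IsCogenerator S 𝒯 (leftPerp S 𝒯)

end Notions

end Extri

/-!
Everything rests on the vanishing `ExtZero` of extension groups along conflations.

*Dimension shift.* Let `A ⟶ B ⟶ X` be a conflation and `K ⟶ P ⟶ Z` one with `P` projective. Since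
each class in `𝔼(Z, -)` is a pushout of the class of the second conflation, `𝔼(K, -)` behaves like
the second extension group of `Z`: the vanishing of `𝔼(K, A)` and `𝔼(Z, B)` gives that of
`𝔼(Z, X)` (`ExtZero.snd`), and the vanishing of `𝔼(K, B)` and `𝔼(Z, X)` gives that of `𝔼(K, A)`
(`ExtZero.fst`). For a conflation `Y ⟶ I ⟶ ΣY` with `I` injective this shows that `𝔼(Ωⁱ X, Y)`
vanishes if and only if `𝔼(X, Σⁱ Y)` does (`extZero_syzygy_iterate_iff`).

*Tilting implies `Presⁿ(𝒯) = 𝒯^⊥`.* Iterating the generator property presents each object of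
`𝒯^⊥`. Conversely, for `A' ⟶ T_n ⟶ ⋯ ⟶ T_1 ⟶ A`, dimension shift reduces the vanishing of
`𝔼ⁱ(T, A)` to that of `𝔼ⁱ⁺ⁿ(T, A')`, and this group is zero as `pd T ≤ n`.

*`Presⁿ(𝒯) = 𝒯^⊥` implies tilting.* For `Y ∈ 𝒯^⊥` a deflation `T_1 ⟶ Y` and a right approximation
`T_0 ⟶ Y` together form a deflation `T_1 ⊞ T_0 ⟶ Y` that is an approximation, so that its kernel
lies in `𝒯^⊥` (`rightPerp_fst`); no idempotent completeness is needed. Hence `𝒯` generates `𝒯^⊥`.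
Injective objects lie in `𝒯^⊥`, so `Σⁿ Y` is presented by `𝒯^⊥` for each `Y`. As `𝒯^⊥` is closed
under extensions and generated by `𝒯`, it follows that `Σⁿ Y ∈ Presⁿ(𝒯) = 𝒯^⊥`
(`IsGenerator.pres_of_pres`). Thus `𝔼(Ωⁿ T, Y)` vanishes for all `Y`, so `Ωⁿ T` is projective.

The statement on cotilting subcategories is the one on tilting subcategories for the opposite
extriangulated category `ExtriangulatedStructure.op`; the two-sided dimension shift identifies
`^⊥𝒯`, which is defined by syzygies in `C`, with the right orthogonal in `Cᵒᵖ`.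
-/

namespace Extri

variable {C : Type u} [Category.{v} C]

/-! ### Functoriality of extensions -/

section Bifunctor

variable (E : Cᵒᵖ ⥤ C ⥤ AddCommGrpCat.{w})

@[simp]
theorem push_zero_right {X A A' : C} (a : A ⟶ A') : push E a (0 : ExtOf E X A) = 0 :=
  map_zero _

@[simp]
theorem pull_zero_right {X X' A : C} (c : X' ⟶ X) : pull E c (0 : ExtOf E X A) = 0 :=
  map_zero _

theorem push_add_right {X A A' : C} (a : A ⟶ A') (δ δ' : ExtOf E X A) :
    push E a (δ + δ') = push E a δ + push E a δ' :=
  map_add _ _ _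

theorem pull_add_right {X X' A : C} (c : X' ⟶ X) (δ δ' : ExtOf E X A) :
    pull E c (δ + δ') = pull E c δ + pull E c δ' :=
  map_add _ _ _

@[simp]
theorem push_id {X A : C} (δ : ExtOf E X A) : push E (𝟙 A) δ = δ := by
  simp [push]

@[simp]
theorem pull_id {X A : C} (δ : ExtOf E X A) : pull E (𝟙 X) δ = δ := by
  simp [pull]

theorem push_push {X A A' A'' : C} (a : A ⟶ A') (a' : A' ⟶ A'') (δ : ExtOf E X A) :
    push E a' (push E a δ) = push E (a ≫ a') δ := by
  simp [push]

theorem pull_pull {X X' X'' A : C} (c : X' ⟶ X) (c' : X'' ⟶ X') (δ : ExtOf E X A) :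
    pull E c' (pull E c δ) = pull E (c' ≫ c) δ := by
  simp [pull]

theorem push_pull {X X' A A' : C} (c : X' ⟶ X) (a : A ⟶ A') (δ : ExtOf E X A) :
    push E a (pull E c δ) = pull E c (push E a δ) := by
  have := (E.map c.op).naturality a
  exact congrArg (fun f => f.hom δ) this.symm

end Bifunctor

/-- The extension group `𝔼(X, A)` vanishes. -/
def ExtZero (E : Cᵒᵖ ⥤ C ⥤ AddCommGrpCat.{w}) (X A : C) : Prop :=
  ∀ δ : ExtOf E X A, δ = 0

theorem seqClass_eq_of_iso {A B B' X : C} {x : A ⟶ B} {y : B ⟶ X} {x' : A ⟶ B'} {y' : B' ⟶ X}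
    (b : B ≅ B') (hx : x ≫ b.hom = x') (hy : b.hom ≫ y' = y) : seqClass x y = seqClass x' y' :=
  Quotient.sound (s := seqSetoid A X) ⟨b, hx, hy⟩

theorem exists_iso_of_seqClass_eq {A B B' X : C} {x : A ⟶ B} {y : B ⟶ X} {x' : A ⟶ B'}
    {y' : B' ⟶ X} (h : seqClass x y = seqClass x' y') :
    ∃ b : B ≅ B', x ≫ b.hom = x' ∧ b.hom ≫ y' = y :=
  Quotient.exact (s := seqSetoid A X) h

theorem exists_eq_seqClass {A X : C} (c : SeqClass A X) :
    ∃ (B : C) (x : A ⟶ B) (y : B ⟶ X), c = seqClass x y := by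
  obtain ⟨p, rfl⟩ := Quotient.exists_rep c
  exact ⟨p.mid, p.fst, p.snd, rfl⟩

/-! ### Opposites of sequences and subcategories -/

/-- The class in `Cᵒᵖ` of the opposite of a sequence. -/
def SeqClass.op {A X : Cᵒᵖ} : SeqClass X.unop A.unop → SeqClass A X :=
  Quotient.map (fun p => ⟨Opposite.op p.mid, p.snd.op, p.fst.op⟩) (by
    rintro p q ⟨b, h₁, h₂⟩
    exact ⟨b.symm.op, Quiver.Hom.unop_inj (by simp [← h₂]), Quiver.Hom.unop_inj (by simp [← h₁])⟩)

theorem SeqClass.op_eq_seqClass_iff {A B X : Cᵒᵖ} {c : SeqClass X.unop A.unop} {x : A ⟶ B}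
    {y : B ⟶ X} : c.op = seqClass x y ↔ c = seqClass y.unop x.unop := by
  obtain ⟨B', x', y', rfl⟩ := exists_eq_seqClass c
  constructor
  · intro h
    obtain ⟨b, h₁, h₂⟩ := exists_iso_of_seqClass_eq (x := y'.op) (y := x'.op) h
    exact seqClass_eq_of_iso b.unop.symm
      (by simpa using (congrArg Quiver.Hom.unop ((Iso.eq_inv_comp b).2 h₂)).symm) (by simp [← h₁])
  · intro h
    rw [h]
    rfl

theorem HasLeftApprox.op {𝒯 : ObjectProperty C} {B : C} (h : HasLeftApprox 𝒯 B) :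
    HasRightApprox 𝒯.op (Opposite.op B) := by
  obtain ⟨Y, f, hY, hf⟩ := h
  refine ⟨Opposite.op Y, f.op, hY, fun Y' hY' g => ?_⟩
  obtain ⟨k, hk⟩ := hf _ hY' g.unop
  exact ⟨k.op, Quiver.Hom.unop_inj hk⟩

section Biproducts

variable [Preadditive C] [HasBinaryBiproducts C]

instance hasBinaryBiproducts_op : HasBinaryBiproducts Cᵒᵖ :=
  HasBinaryBiproducts.of_hasBinaryProducts

/-- The isomorphism between the biproduct of two objects and their biproduct in `Cᵒᵖ`. -/
noncomputable def biprodUnop (A B : Cᵒᵖ) : A.unop ⊞ B.unop ≅ (A ⊞ B).unop where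
  hom := biprod.desc (biprod.fst : A ⊞ B ⟶ A).unop (biprod.snd : A ⊞ B ⟶ B).unop
  inv := biprod.lift (biprod.inl : A ⟶ A ⊞ B).unop (biprod.inr : B ⟶ A ⊞ B).unop
  hom_inv_id := by
    ext <;> simp [← unop_comp]
  inv_hom_id := by
    simp [← unop_comp, ← unop_add]

theorem IsAdditiveSubcategory.op {𝒯 : ObjectProperty C} (h : IsAdditiveSubcategory 𝒯) :
    IsAdditiveSubcategory 𝒯.op where
  iso e hA := h.iso e.unop.symm hA
  zero _ hZ := h.zero _ hZ.unop
  biprod A B hA hB := h.iso (biprodUnop A B) (h.biprod _ _ hA hB)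

theorem ClosedUnderSummands.op {𝒯 : ObjectProperty C} (h𝒯 : IsAdditiveSubcategory 𝒯)
    (h : ClosedUnderSummands 𝒯) : ClosedUnderSummands 𝒯.op :=
  fun A B hAB => h _ _ (h𝒯.iso (biprodUnop A B).symm hAB)

end Biproducts

variable [Preadditive C] [HasZeroObject C] [HasBinaryBiproducts C]
  {S : ExtriangulatedStructure.{w} C}

/-! ### Exact sequences attached to a conflation -/

section Exact

variable {A B X : C} {x : A ⟶ B} {y : B ⟶ X} {δ : ExtOf S.E X A}

theorem comp_eq_zero (h : S.s δ = seqClass x y) : x ≫ y = 0 := by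
  obtain ⟨c, hc, -⟩ := S.et3 _ _ x y _ δ (S.s_zero A X) h (𝟙 A) (biprod.desc x 0) (by simp)
  simpa using (congrArg (fun f => biprod.inl ≫ f) hc).symm

theorem push_fst_eq_zero (h : S.s δ = seqClass x y) : push S.E x δ = 0 := by
  obtain ⟨c, -, hc⟩ := S.et3 x y _ _ δ _ h (S.s_zero B X) x (biprod.lift (𝟙 B) y)
    (by ext <;> simp [comp_eq_zero h])
  simpa using hc

theorem pull_snd_eq_zero (h : S.s δ = seqClass x y) : pull S.E y δ = 0 := by
  obtain ⟨a, -, ha⟩ := S.et3_op _ _ x y _ δ (S.s_zero A B) h (biprod.desc x (𝟙 B)) y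
    (by ext <;> simp [comp_eq_zero h])
  simpa using ha.symm

/-- Exactness of `Hom(X, Z) ⟶ Hom(B, Z) ⟶ Hom(A, Z)`. -/
theorem exists_factor_snd (h : S.s δ = seqClass x y) {Z : C} (g : B ⟶ Z) (hg : x ≫ g = 0) :
    ∃ k : X ⟶ Z, y ≫ k = g := by
  obtain ⟨c, hc, -⟩ := S.et3 x y _ _ δ _ h (S.s_zero A Z) 0 (g ≫ biprod.inr)
    (by simp [reassoc_of% hg])
  exact ⟨c, by simpa using hc⟩

/-- Exactness of `Hom(B, Z) ⟶ Hom(A, Z) ⟶ 𝔼(X, Z)`. -/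
theorem exists_extend (h : S.s δ = seqClass x y) {Z : C} (f : A ⟶ Z) (hf : push S.E f δ = 0) :
    ∃ g : B ⟶ Z, x ≫ g = f := by
  obtain ⟨b, hb, -⟩ := S.realization x y _ _ δ 0 h (S.s_zero Z X) f (𝟙 X) (by simpa using hf)
  exact ⟨b ≫ biprod.fst, by simp [reassoc_of% hb]⟩

/-- Exactness of `Hom(Z, B) ⟶ Hom(Z, X) ⟶ 𝔼(Z, A)`. -/
theorem exists_lift (h : S.s δ = seqClass x y) {Z : C} (f : Z ⟶ X) (hf : pull S.E f δ = 0) :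
    ∃ g : Z ⟶ B, g ≫ y = f := by
  obtain ⟨b, -, hb⟩ := S.realization _ _ x y 0 δ (S.s_zero A Z) h (𝟙 A) f (by simpa using hf.symm)
  exact ⟨biprod.inr ≫ b, by simp [← hb]⟩

/-- Exactness of `Hom(A, Z) ⟶ 𝔼(X, Z) ⟶ 𝔼(B, Z)`. -/
theorem exists_eq_push (h : S.s δ = seqClass x y) {Z : C} (ε : ExtOf S.E X Z)
    (hε : pull S.E y ε = 0) : ∃ f : A ⟶ Z, push S.E f δ = ε := by
  obtain ⟨W, p, q, hW⟩ := exists_eq_seqClass (S.s ε)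
  obtain ⟨g, hg⟩ := exists_lift hW y hε
  obtain ⟨a, -, ha⟩ := S.et3_op x y p q δ ε h hW g (𝟙 X) (by simp [hg])
  exact ⟨a, by simpa using ha⟩

/-- Exactness of `Hom(Z, X) ⟶ 𝔼(Z, A) ⟶ 𝔼(Z, B)`. -/
theorem exists_eq_pull (h : S.s δ = seqClass x y) {Z : C} (ε : ExtOf S.E Z A)
    (hε : push S.E x ε = 0) : ∃ f : Z ⟶ X, pull S.E f δ = ε := by
  obtain ⟨W, p, q, hW⟩ := exists_eq_seqClass (S.s ε)
  obtain ⟨g, hg⟩ := exists_extend hW x hε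
  obtain ⟨c, -, hc⟩ := S.et3 p q x y ε δ hW h (𝟙 A) g (by simp [hg])
  exact ⟨c, by simpa using hc.symm⟩

/-- Exactness of `𝔼(Z, A) ⟶ 𝔼(Z, B) ⟶ 𝔼(Z, X)`. -/
theorem exists_push_fst_eq (h : S.s δ = seqClass x y) {Z : C} (ε : ExtOf S.E Z B)
    (hε : push S.E y ε = 0) : ∃ ε' : ExtOf S.E Z A, push S.E x ε' = ε := by
  obtain ⟨W, p, q, hW⟩ := exists_eq_seqClass (S.s ε)
  obtain ⟨N, -, -, d, e, δ'', -, -, -, -, hde, -, hx⟩ := S.et4 x y p q δ ε h hW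
  -- `e` realizes the zero extension `y_* ε`, so it has a section `r`, and `r^* δ''` works.
  obtain ⟨r, hr⟩ := exists_lift hde (𝟙 Z) (by simp [hε])
  exact ⟨pull S.E r δ'', by rw [push_pull, hx, pull_pull, hr, pull_id]⟩

end Exact

/-! ### Constructions of conflations -/

/-- An endomorphism of the middle term of a conflation that induces the identity on both ends is
an isomorphism: its difference with the identity has square zero. -/
theorem isIso_of_comp_eq {A B X : C} {x : A ⟶ B} {y : B ⟶ X} {δ : ExtOf S.E X A}
    (h : S.s δ = seqClass x y) (b : B ⟶ B) (hx : x ≫ b = x) (hy : b ≫ y = y) : IsIso b := by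
  obtain ⟨k, hk⟩ := exists_factor_snd h (b - 𝟙 B) (by simp [hx])
  have hsq : (b - 𝟙 B) ≫ (b - 𝟙 B) = 0 := by
    rw [← hk, ← Category.assoc, hk, Preadditive.sub_comp, hy, Category.id_comp, sub_self,
      zero_comp]
  have hb : b ≫ b = b + b - 𝟙 B := by
    simp only [Preadditive.sub_comp, Preadditive.comp_sub, Category.id_comp,
      Category.comp_id] at hsq
    rw [sub_sub, sub_eq_zero] at hsq
    rw [hsq]
    abel
  exact ⟨𝟙 B + 𝟙 B - b, by simp [Preadditive.comp_sub, Preadditive.comp_add, hb],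
    by simp [Preadditive.sub_comp, Preadditive.add_comp, hb]⟩

/-- Realizations are invariant under isomorphisms of extensions. -/
theorem realizes_of_iso {A B X A' X' : C} {x : A ⟶ B} {y : B ⟶ X} {δ : ExtOf S.E X A}
    (h : S.s δ = seqClass x y) (a : A ≅ A') (c : X ≅ X') (δ' : ExtOf S.E X' A')
    (hδ : push S.E a.hom δ = pull S.E c.hom δ') :
    S.s δ' = seqClass (a.inv ≫ x) (y ≫ c.hom) := by
  obtain ⟨B', x', y', h'⟩ := exists_eq_seqClass (S.s δ')
  obtain ⟨b, hb₁, hb₂⟩ := S.realization x y x' y' δ δ' h h' a.hom c.hom hδ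
  obtain ⟨b', hb₁', hb₂'⟩ := S.realization x' y' x y δ' δ h' h a.inv c.inv (by
    have := congrArg (fun ε => pull S.E c.inv (push S.E a.inv ε)) hδ
    simpa [push_push, push_pull, pull_pull] using this.symm)
  have h₁ : IsIso (b ≫ b') := isIso_of_comp_eq h _ (by simp [reassoc_of% hb₁, hb₁'])
    (by simp [← hb₂', ← reassoc_of% hb₂])
  have h₂ : IsIso (b' ≫ b) := isIso_of_comp_eq h' _ (by simp [reassoc_of% hb₁', hb₁])
    (by simp [← hb₂, ← reassoc_of% hb₂'])
  have : IsSplitMono b := ⟨⟨b' ≫ inv (b ≫ b'), by rw [← Category.assoc, IsIso.hom_inv_id]⟩⟩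
  have : Epi b := epi_of_epi b' b
  have : IsIso b := isIso_of_epi_of_isSplitMono b
  rw [h']
  exact (seqClass_eq_of_iso (asIso b) (by simp [hb₁]) (by simp [hb₂])).symm

theorem IsConflation.comp_iso {A B X X' : C} {x : A ⟶ B} {y : B ⟶ X} (h : IsConflation S x y)
    (c : X ≅ X') : IsConflation S x (y ≫ c.hom) := by
  obtain ⟨δ, h⟩ := h
  exact ⟨pull S.E c.inv δ, by simpa using realizes_of_iso h (Iso.refl A) c _ (by simp [pull_pull])⟩

/-- A split short exact sequence realizes the zero extension. -/
theorem realizes_zero_of_split {A B X : C} (i : A ⟶ B) (p : B ⟶ X) (r : B ⟶ A) (q : X ⟶ B)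
    (hir : i ≫ r = 𝟙 A) (hip : i ≫ p = 0) (hqr : q ≫ r = 0) (hqp : q ≫ p = 𝟙 X)
    (hid : r ≫ i + p ≫ q = 𝟙 B) : S.s (0 : ExtOf S.E X A) = seqClass i p := by
  rw [S.s_zero]
  refine seqClass_eq_of_iso ⟨biprod.desc i q, biprod.lift r p, ?_, ?_⟩ ?_ ?_
  · ext <;> simp [hir, hip, hqr, hqp]
  · simp [hid]
  · simp
  · ext <;> simp [hip, hqp]

theorem isConflation_id (X : C) {Z : C} (hZ : IsZero Z) :
    IsConflation S (hZ.to_ X) (𝟙 X) :=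
  ⟨0, realizes_zero_of_split _ _ (hZ.from_ X) (𝟙 X) (hZ.eq_of_src _ _) (hZ.eq_of_src _ _)
    (hZ.eq_of_tgt _ _) (by simp) (by rw [hZ.eq_of_tgt (hZ.from_ X) 0]; simp)⟩

/-- The kernels of two deflations onto the same object are also the kernels of the two deflations
out of some object `M`, which plays the role of their pullback. -/
theorem exists_pullback {A₁ B₁ A₂ B₂ X : C} {x₁ : A₁ ⟶ B₁} {y₁ : B₁ ⟶ X} {x₂ : A₂ ⟶ B₂}
    {y₂ : B₂ ⟶ X} (h₁ : IsConflation S x₁ y₁) (h₂ : IsConflation S x₂ y₂) :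
    ∃ (M : C) (m₁ : A₁ ⟶ M) (e₁ : M ⟶ B₂) (m₂ : A₂ ⟶ M) (e₂ : M ⟶ B₁),
      IsConflation S m₁ e₁ ∧ IsConflation S m₂ e₂ := by
  obtain ⟨δ₁, h₁⟩ := h₁
  obtain ⟨δ₂, h₂⟩ := h₂
  -- `M` realizes the extension of `X` by `A₁ ⊞ A₂` with components `δ₁` and `δ₂`. By (ET4),
  -- dividing out `A₁` leaves a realization of `δ₂`, and vice versa.
  obtain ⟨M, j, k, hM⟩ := exists_eq_seqClass
    (S.s (push S.E (biprod.inl : A₁ ⟶ A₁ ⊞ A₂) δ₁ + push S.E (biprod.inr : A₂ ⟶ A₁ ⊞ A₂) δ₂))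
  have hinl : S.s (0 : ExtOf S.E A₂ A₁) =
      seqClass (biprod.inl : A₁ ⟶ A₁ ⊞ A₂) (biprod.snd : A₁ ⊞ A₂ ⟶ A₂) := S.s_zero _ _
  have hinr : S.s (0 : ExtOf S.E A₁ A₂) =
      seqClass (biprod.inr : A₂ ⟶ A₁ ⊞ A₂) (biprod.fst : A₁ ⊞ A₂ ⟶ A₁) :=
    realizes_zero_of_split _ _ biprod.snd biprod.inl (by simp) (by simp) (by simp) (by simp)
      (by rw [add_comm, biprod.total])
  have push_zero : ∀ {X A A' : C} (ε : ExtOf S.E X A), push S.E (0 : A ⟶ A') ε = 0 := by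
    intro X A A' ε
    simpa using S.push_add (0 : A ⟶ A') 0 ε
  obtain ⟨N₁, h, h', d, e, ε₁, -, -, -, hε₁, hde, -⟩ := S.et4 _ _ j k _ _ hinl hM
  simp only [push_add_right, push_push, biprod.inl_snd, biprod.inr_snd, push_id, push_zero,
    zero_add, h₂] at hde
  obtain ⟨b₁, -⟩ := exists_iso_of_seqClass_eq hde
  obtain ⟨N₂, l, l', d', e', ε₂, -, -, -, hε₂, hde', -⟩ := S.et4 _ _ j k _ _ hinr hM
  simp only [push_add_right, push_push, biprod.inl_fst, biprod.inr_fst, push_id, push_zero,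
    add_zero, h₁] at hde'
  obtain ⟨b₂, -⟩ := exists_iso_of_seqClass_eq hde'
  exact ⟨M, h, h' ≫ b₁.inv, l, l' ≫ b₂.inv, IsConflation.comp_iso ⟨ε₁, hε₁⟩ b₁.symm,
    IsConflation.comp_iso ⟨ε₂, hε₂⟩ b₂.symm⟩

/-- The composite of two deflations is a deflation, and its kernel is an extension of the two
kernels. -/
theorem exists_conflation_comp {D A B F M : C} {f' : D ⟶ A} {f : A ⟶ B} {g' : F ⟶ B}
    {g : B ⟶ M} (hf : IsConflation S f' f) (hg : IsConflation S g' g) :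
    ∃ (N : C) (d : D ⟶ N) (e : N ⟶ F) (k : N ⟶ A),
      IsConflation S k (f ≫ g) ∧ IsConflation S d e := by
  obtain ⟨δ, hf⟩ := hf
  obtain ⟨δ', hg⟩ := hg
  obtain ⟨N, d, e, h', h, δ'', -, -, rfl, hh, hde, -⟩ := S.et4_op f' f g' g δ δ' hf hg
  exact ⟨N, d, e, h', ⟨δ'', hh⟩, _, hde⟩

/-- If `g` is a deflation, then so is `(g, f)` for each morphism `f` with the same target. -/
theorem exists_conflation_desc {A B X Y : C} {x : A ⟶ B} {g : B ⟶ X} (hg : IsConflation S x g)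
    (f : Y ⟶ X) : ∃ (K : C) (k : K ⟶ B ⊞ Y), IsConflation S k (biprod.desc g f) := by
  obtain ⟨δ, hg⟩ := hg
  obtain ⟨δ₀, h₀⟩ := isConflation_id (S := S) Y (isZero_zero C)
  -- `(g, f)` is the composite of `g ⊞ 𝟙` with the split deflation `(𝟙, f)`.
  have hsplit : IsConflation S (biprod.lift (-f) (𝟙 Y)) (biprod.desc (𝟙 X) f) :=
    ⟨0, realizes_zero_of_split _ _ biprod.snd biprod.inl (by simp) (by simp) (by simp) (by simp)
      (by ext <;> simp)⟩
  obtain ⟨K, -, -, k, hk, -⟩ := exists_conflation_comp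
    ⟨_, S.s_sum x g _ (𝟙 Y) δ δ₀ hg h₀⟩ hsplit
  refine ⟨K, k, ?_⟩
  have : biprod.map g (𝟙 Y) ≫ biprod.desc (𝟙 X) f = biprod.desc g f := by ext <;> simp
  rwa [this] at hk

/-! ### The opposite extriangulated category -/

/-- The opposite extriangulated category: `𝔼ᵒᵖ(X, A) = 𝔼(A, X)`, and a sequence realizes an
extension in `Cᵒᵖ` if its opposite does so in `C`. -/
noncomputable def ExtriangulatedStructure.op (S : ExtriangulatedStructure.{w} C) :
    ExtriangulatedStructure.{w} Cᵒᵖ where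
  E := unopUnop C ⋙ S.E.flip
  push_add a a' δ := S.pull_add a.unop a'.unop δ
  pull_add c c' δ := S.push_add c.unop c'.unop δ
  s {X A} δ := SeqClass.op (S.s (X := A.unop) (A := X.unop) δ)
  realization x y x' y' δ δ' h h' a c hac := by
    rw [SeqClass.op_eq_seqClass_iff] at h h'
    obtain ⟨b, h₁, h₂⟩ := S.realization _ _ _ _ _ _ h' h c.unop a.unop hac.symm
    exact ⟨b.op, Quiver.Hom.unop_inj h₂.symm, Quiver.Hom.unop_inj h₁.symm⟩
  s_zero A X := by
    rw [SeqClass.op_eq_seqClass_iff]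
    exact realizes_zero_of_split _ _ (biprod.inr : X ⟶ A ⊞ X).unop (biprod.fst : A ⊞ X ⟶ A).unop
      (by simp [← unop_comp]) (by simp [← unop_comp]) (by simp [← unop_comp])
      (by simp [← unop_comp]) (by simp [← unop_comp, ← unop_add, add_comm])
  s_sum {A B X A' B' X'} x y x' y' δ δ' h h' := by
    rw [SeqClass.op_eq_seqClass_iff] at h h' ⊢
    have key := realizes_of_iso (S.s_sum _ _ _ _ _ _ h h') (biprodUnop X X') (biprodUnop A A')
      (pull S.E (biprod.inl : A ⟶ A ⊞ A').unop (push S.E (biprod.fst : X ⊞ X' ⟶ X).unop δ) +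
       pull S.E (biprod.inr : A' ⟶ A ⊞ A').unop (push S.E (biprod.snd : X ⊞ X' ⟶ X').unop δ')) ?_
    · refine key.trans (seqClass_eq_of_iso (biprodUnop B B') ?_ ?_)
      · rw [Category.assoc, Iso.inv_comp_eq]
        ext <;> simp [biprodUnop, ← unop_comp]
      · ext <;> simp [biprodUnop, ← unop_comp]
    · have h₁ : (biprodUnop A A').hom ≫ (biprod.inl : A ⟶ A ⊞ A').unop = biprod.fst := by
        ext <;> simp [biprodUnop, ← unop_comp]
      have h₂ : (biprodUnop A A').hom ≫ (biprod.inr : A' ⟶ A ⊞ A').unop = biprod.snd := by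
        ext <;> simp [biprodUnop, ← unop_comp]
      simp only [push_add_right, pull_add_right, push_push, pull_pull, push_pull, h₁, h₂]
      simp [biprodUnop]
  et3 x y x' y' δ δ' h h' a b hab := by
    rw [SeqClass.op_eq_seqClass_iff] at h h'
    obtain ⟨c, h₁, h₂⟩ := S.et3_op _ _ _ _ _ _ h' h b.unop a.unop
      (congrArg Quiver.Hom.unop hab).symm
    exact ⟨c.op, Quiver.Hom.unop_inj h₁.symm, h₂.symm⟩
  et3_op x y x' y' δ δ' h h' b c hbc := by
    rw [SeqClass.op_eq_seqClass_iff] at h h'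
    obtain ⟨a, h₁, h₂⟩ := S.et3 _ _ _ _ _ _ h' h c.unop b.unop (congrArg Quiver.Hom.unop hbc).symm
    exact ⟨a.op, Quiver.Hom.unop_inj h₁.symm, h₂.symm⟩
  et4 f f' g g' δ δ' h h' := by
    rw [SeqClass.op_eq_seqClass_iff] at h h'
    obtain ⟨N, d, e, k', k, δ'', h₁, h₂, h₃, h₄, h₅, h₆, h₇⟩ := S.et4_op _ _ _ _ _ _ h' h
    refine ⟨Opposite.op N, k.op, k'.op, e.op, d.op, δ'', Quiver.Hom.unop_inj h₃,
      Quiver.Hom.unop_inj h₂, Quiver.Hom.unop_inj h₁, ?_, ?_, h₆, h₇.symm⟩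
    · rw [SeqClass.op_eq_seqClass_iff]; exact h₄
    · rw [SeqClass.op_eq_seqClass_iff]; exact h₅
  et4_op f' f g' g δ δ' h h' := by
    rw [SeqClass.op_eq_seqClass_iff] at h h'
    obtain ⟨N, k, k', d, e, δ'', h₁, h₂, h₃, h₄, h₅, h₆, h₇⟩ := S.et4 _ _ _ _ _ _ h' h
    refine ⟨Opposite.op N, e.op, d.op, k'.op, k.op, δ'', Quiver.Hom.unop_inj h₃,
      Quiver.Hom.unop_inj h₂, Quiver.Hom.unop_inj h₁, ?_, ?_, h₆, h₇.symm⟩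
    · rw [SeqClass.op_eq_seqClass_iff]; exact h₄
    · rw [SeqClass.op_eq_seqClass_iff]; exact h₅

/-! ### Projective and injective objects -/

theorem IsProj.extZero {P : C} (hP : IsProj S P) (A : C) : ExtZero S.E P A := by
  intro ε
  obtain ⟨B, x, y, h⟩ := exists_eq_seqClass (S.s ε)
  obtain ⟨b, hb⟩ := hP x y ⟨ε, h⟩ (𝟙 P)
  rw [← pull_id S.E ε, ← hb, ← pull_pull, pull_snd_eq_zero h, pull_zero_right]

theorem isProj_of_extZero {P : C} (h : ∀ A, ExtZero S.E P A) : IsProj S P := by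
  rintro A B X x y ⟨δ, hδ⟩ c
  exact exists_lift hδ c (h A _)

theorem IsInj.extZero {I : C} (hI : IsInj S I) (X : C) : ExtZero S.E X I := by
  intro ε
  obtain ⟨B, x, y, h⟩ := exists_eq_seqClass (S.s ε)
  obtain ⟨b, hb⟩ := hI x y ⟨ε, h⟩ (𝟙 I)
  rw [← push_id S.E ε, ← hb, ← push_push, push_fst_eq_zero h, push_zero_right]

variable (S) in
theorem exists_conflation_syzygy [EnoughProj S] (X : C) :
    ∃ (P : C) (x : syzygy S X ⟶ P) (y : P ⟶ X), IsProj S P ∧ IsConflation S x y :=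
  (EnoughProj.exists_conflation (S := S) X).choose_spec

/-! ### Vanishing of extensions along conflations -/

theorem ExtZero.mid {A B X : C} {x : A ⟶ B} {y : B ⟶ X} (h : IsConflation S x y) {Z : C}
    (hA : ExtZero S.E Z A) (hX : ExtZero S.E Z X) : ExtZero S.E Z B := by
  obtain ⟨δ, h⟩ := h
  intro ε
  obtain ⟨ε', rfl⟩ := exists_push_fst_eq h ε (hX _)
  rw [hA ε', push_zero_right]

/-- For a conflation `K ⟶ P ⟶ Z` with `P` projective, `𝔼(K, -)` plays the role of the second
extension group of `Z`. -/
theorem ExtZero.fst {A B X : C} {x : A ⟶ B} {y : B ⟶ X} (h : IsConflation S x y) {K P Z : C}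
    {i : K ⟶ P} {p : P ⟶ Z} (hP : IsProj S P) (hK : IsConflation S i p)
    (hB : ExtZero S.E K B) (hX : ExtZero S.E Z X) : ExtZero S.E K A := by
  have ⟨δ, hδ⟩ := h
  obtain ⟨ω, hω⟩ := hK
  intro ε
  obtain ⟨f, rfl⟩ := exists_eq_pull hδ ε (hB _)
  obtain ⟨g, rfl⟩ := exists_extend hω f (hX _)
  obtain ⟨g', rfl⟩ := hP x y h g
  rw [← Category.assoc, ← pull_pull, pull_snd_eq_zero hδ, pull_zero_right]

theorem ExtZero.snd {A B X : C} {x : A ⟶ B} {y : B ⟶ X} (h : IsConflation S x y) {K P Z : C}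
    {i : K ⟶ P} {p : P ⟶ Z} (hP : IsProj S P) (hK : IsConflation S i p)
    (hA : ExtZero S.E K A) (hB : ExtZero S.E Z B) : ExtZero S.E Z X := by
  obtain ⟨δ, hδ⟩ := h
  obtain ⟨ω, hω⟩ := hK
  intro ε
  obtain ⟨f, rfl⟩ := exists_eq_push hω ε (hP.extZero _ _)
  obtain ⟨g, rfl⟩ := exists_lift hδ f (hA _)
  rw [← push_push, hB (push S.E g ω), push_zero_right]

/-! ### Cosyzygies -/

theorem isConflation_op_iff {A B X : Cᵒᵖ} {x : A ⟶ B} {y : B ⟶ X} :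
    IsConflation S.op x y ↔ IsConflation S y.unop x.unop :=
  exists_congr fun _ => SeqClass.op_eq_seqClass_iff

theorem isProj_op_iff {P : Cᵒᵖ} : IsProj S.op P ↔ IsInj S P.unop := by
  constructor
  · intro h A B X x y hxy a
    obtain ⟨b, hb⟩ := h y.op x.op (isConflation_op_iff.2 hxy) a.op
    exact ⟨b.unop, Quiver.Hom.op_inj hb⟩
  · intro h A B X x y hxy c
    obtain ⟨b, hb⟩ := h _ _ (isConflation_op_iff.1 hxy) c.unop
    exact ⟨b.op, Quiver.Hom.unop_inj hb⟩

theorem isInj_op_iff {P : Cᵒᵖ} : IsInj S.op P ↔ IsProj S P.unop := by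
  constructor
  · intro h A B X x y hxy a
    obtain ⟨b, hb⟩ := h y.op x.op (isConflation_op_iff.2 hxy) a.op
    exact ⟨b.unop, Quiver.Hom.op_inj hb⟩
  · intro h A B X x y hxy c
    obtain ⟨b, hb⟩ := h _ _ (isConflation_op_iff.1 hxy) c.unop
    exact ⟨b.op, Quiver.Hom.unop_inj hb⟩

instance enoughProj_op [EnoughInj S] : EnoughProj S.op where
  exists_conflation X := by
    obtain ⟨I, L, x, y, hI, h⟩ := EnoughInj.exists_conflation (S := S) X.unop
    exact ⟨op L, op I, y.op, x.op, isProj_op_iff.2 hI, isConflation_op_iff.2 h⟩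

instance enoughInj_op [EnoughProj S] : EnoughInj S.op where
  exists_conflation X := by
    obtain ⟨K, P, x, y, hP, h⟩ := EnoughProj.exists_conflation (S := S) X.unop
    exact ⟨op P, op K, y.op, x.op, isInj_op_iff.2 hP, isConflation_op_iff.2 h⟩

variable (S) in
/-- A cosyzygy of `X`: a syzygy of `X` in the opposite category. -/
noncomputable def cosyzygy [EnoughInj S] (X : C) : C :=
  (syzygy S.op (op X)).unop

variable (S) in
theorem exists_conflation_cosyzygy [EnoughInj S] (X : C) :
    ∃ (I : C) (x : X ⟶ I) (y : I ⟶ cosyzygy S X), IsInj S I ∧ IsConflation S x y := by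
  obtain ⟨P, x, y, hP, h⟩ := exists_conflation_syzygy S.op (op X)
  exact ⟨P.unop, y.unop, x.unop, isProj_op_iff.1 hP, isConflation_op_iff.1 h⟩

theorem syzygy_op_iterate [EnoughInj S] (i : ℕ) (X : Cᵒᵖ) :
    (syzygy S.op)^[i] X = op ((cosyzygy S)^[i] X.unop) := by
  induction i generalizing X with
  | zero => rfl
  | succ i ih => exact ih _

/-- The higher extension groups can be computed by syzygies of the first argument as well as by
cosyzygies of the second. -/
theorem extZero_syzygy_iterate_iff [EnoughProj S] [EnoughInj S] (i : ℕ) (X Y : C) :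
    ExtZero S.E ((syzygy S)^[i] X) Y ↔ ExtZero S.E X ((cosyzygy S)^[i] Y) := by
  induction i generalizing X with
  | zero => rfl
  | succ i ih =>
    obtain ⟨P, j, p, hP, hK⟩ := exists_conflation_syzygy S X
    obtain ⟨I, x, y, hI, h⟩ := exists_conflation_cosyzygy S ((cosyzygy S)^[i] Y)
    rw [Function.iterate_succ_apply, ih, Function.iterate_succ_apply']
    exact ⟨fun hA => .snd h hP hK hA (hI.extZero _), fun hX => .fst h hP hK (hI.extZero _) hX⟩

/-! ### Orthogonal subcategories -/

section RightPerp

variable [EnoughProj S] {𝒯 : ObjectProperty C}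

theorem IsInj.rightPerp {I : C} (hI : IsInj S I) : rightPerp S 𝒯 I :=
  fun _ _ _ => hI.extZero _

theorem rightPerp_mid {A B X : C} {x : A ⟶ B} {y : B ⟶ X} (h : IsConflation S x y)
    (hA : rightPerp S 𝒯 A) (hX : rightPerp S 𝒯 X) : rightPerp S 𝒯 B :=
  fun i T hT => ExtZero.mid h (hA i T hT) (hX i T hT)

/-- The kernel of a deflation in `𝒯^⊥` lies in `𝒯^⊥` if each morphism from `𝒯` to the target
lifts along the deflation. -/
theorem rightPerp_fst {A B X : C} {x : A ⟶ B} {y : B ⟶ X} (h : IsConflation S x y)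
    (hB : rightPerp S 𝒯 B) (hX : rightPerp S 𝒯 X)
    (hy : ∀ T, 𝒯 T → ∀ g : T ⟶ X, ∃ k : T ⟶ B, k ≫ y = g) : rightPerp S 𝒯 A := by
  intro i T hT
  cases i with
  | zero =>
    obtain ⟨δ, hδ⟩ := h
    intro ε
    obtain ⟨f, rfl⟩ := exists_eq_pull hδ ε (hB 0 T hT _)
    obtain ⟨k, rfl⟩ := hy T hT f
    exact (pull_pull S.E y k δ).symm.trans
      ((congrArg (pull S.E k) (pull_snd_eq_zero hδ)).trans (pull_zero_right S.E k))
  | succ i =>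
    obtain ⟨P, j, p, hP, hK⟩ := exists_conflation_syzygy S ((syzygy S)^[i] T)
    have hB' := hB (i + 1) T hT
    unfold HigherExt at hB' ⊢
    rw [Function.iterate_succ_apply'] at hB' ⊢
    exact ExtZero.fst h hP hK hB' (hX i T hT)

/-- Dimension shift along a sequence with terms in `𝒯^⊥`. -/
theorem extZero_of_triangleSeq (h𝒯 : ∀ T, 𝒯 T → rightPerp S 𝒯 T) {n : ℕ} {A A' : C}
    (h : TriangleSeq S 𝒯 n A' A) {T : C} (hT : 𝒯 T) (i : ℕ)
    (hA' : ExtZero S.E ((syzygy S)^[n + i] T) A') : ExtZero S.E ((syzygy S)^[i] T) A := by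
  induction h generalizing i with
  | nil A => simpa using hA'
  | @cons n A' K X A x y hX hxy h ih =>
    obtain ⟨P, j, p, hP, hK⟩ := exists_conflation_syzygy S ((syzygy S)^[i] T)
    have hK' : ExtZero S.E ((syzygy S)^[i + 1] T) K := ih (i + 1)
      (by rwa [show n + (i + 1) = n + 1 + i by omega])
    rw [Function.iterate_succ_apply'] at hK'
    exact .snd hxy hP hK hK' (h𝒯 X hX i T hT)

end RightPerp

/-! ### Projective dimension -/

theorem exists_hasProjResolution_of_projDim_le {A : C} {n : ℕ} (h : projDim S A ≤ n) :
    ∃ m ≤ n, HasProjResolution S m A := by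
  by_contra! hA
  have : ((n + 1 : ℕ) : ℕ∞) ≤ projDim S A :=
    le_iInf₂ fun m hm => by
      by_contra! hmn
      exact hA m (by exact_mod_cast Order.lt_add_one_iff.1 (by exact_mod_cast hmn)) hm
  have := this.trans h
  norm_cast at this
  omega

theorem HasProjResolution.extZero [EnoughInj S] {m : ℕ} {A : C} (h : HasProjResolution S m A)
    (i : ℕ) (Y : C) : ExtZero S.E A ((cosyzygy S)^[m + i] Y) := by
  obtain ⟨P, hP, h⟩ := h
  induction h with
  | nil A => exact hP.extZero _
  | @cons m A' K X A x y hX hxy h ih =>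
    obtain ⟨I, u, v, hI, huv⟩ := exists_conflation_cosyzygy S ((cosyzygy S)^[m + i] Y)
    rw [Nat.add_right_comm, Function.iterate_succ_apply']
    exact .snd huv hX hxy (ih hP) (hI.extZero _)

theorem extZero_of_projDim_le [EnoughProj S] [EnoughInj S] {n : ℕ} {A : C}
    (h : projDim S A ≤ n) (i : ℕ) (Y : C) : ExtZero S.E ((syzygy S)^[n + i] A) Y := by
  obtain ⟨m, hm, hres⟩ := exists_hasProjResolution_of_projDim_le h
  obtain ⟨k, rfl⟩ := Nat.exists_eq_add_of_le hm
  rw [extZero_syzygy_iterate_iff, add_assoc]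
  exact hres.extZero _ _

theorem triangleSeq_syzygy_iterate [EnoughProj S] (n : ℕ) (A : C) :
    TriangleSeq S (IsProj S) n ((syzygy S)^[n] A) A := by
  induction n generalizing A with
  | zero => exact .nil A
  | succ n ih =>
    obtain ⟨P, x, y, hP, h⟩ := exists_conflation_syzygy S A
    exact .cons x y hP h (ih _)

theorem triangleSeq_cosyzygy_iterate [EnoughInj S] (n : ℕ) (A : C) :
    TriangleSeq S (IsInj S) n A ((cosyzygy S)^[n] A) := by
  induction n with
  | zero => exact .nil A
  | succ n ih =>
    obtain ⟨I, x, y, hI, h⟩ := exists_conflation_cosyzygy S ((cosyzygy S)^[n] A)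
    rw [Function.iterate_succ_apply']
    exact .cons x y hI h ih

theorem projDim_le_of_extZero [EnoughProj S] {n : ℕ} {A : C}
    (h : ∀ Y, ExtZero S.E ((syzygy S)^[n] A) Y) : projDim S A ≤ n :=
  iInf₂_le n ⟨_, isProj_of_extZero h, triangleSeq_syzygy_iterate n A⟩

/-! ### Tilting subcategories -/

theorem TriangleSeq.mono {𝒳 𝒴 : ObjectProperty C} (h𝒳 : ∀ X, 𝒳 X → 𝒴 X) {n : ℕ} {A A' : C}
    (h : TriangleSeq S 𝒳 n A' A) : TriangleSeq S 𝒴 n A' A := by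
  induction h with
  | nil A => exact .nil A
  | cons x y hX hxy _ ih => exact .cons x y (h𝒳 _ hX) hxy ih

theorem pres_of_mem {𝒯 : ObjectProperty C} (h𝒯 : IsAdditiveSubcategory 𝒯) (n : ℕ) {T : C}
    (hT : 𝒯 T) : Pres S n 𝒯 T := by
  induction n generalizing T with
  | zero => exact ⟨T, .nil T⟩
  | succ n ih =>
    obtain ⟨A', h⟩ := ih (h𝒯.zero _ (isZero_zero C))
    exact ⟨A', .cons _ _ hT (isConflation_id T (isZero_zero C)) h⟩

theorem IsGenerator.pres {𝒳 𝒴 : ObjectProperty C} (h : IsGenerator S 𝒳 𝒴) (n : ℕ) {Y : C}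
    (hY : 𝒴 Y) : Pres S n 𝒳 Y := by
  induction n generalizing Y with
  | zero => exact ⟨Y, .nil Y⟩
  | succ n ih =>
    obtain ⟨Y', X, x, y, hY', hX, hxy⟩ := h.2 Y hY
    obtain ⟨A', h'⟩ := ih hY'
    exact ⟨A', .cons x y hX hxy h'⟩

/-- If `𝒳` is a generator for `𝒴` and `𝒴` is closed under extensions, then an object that is
presented by `𝒴` is also presented by `𝒳`. -/
theorem IsGenerator.pres_of_pres {𝒳 𝒴 : ObjectProperty C} (h : IsGenerator S 𝒳 𝒴)
    (h𝒴 : ∀ {A B X : C} (x : A ⟶ B) (y : B ⟶ X), IsConflation S x y → 𝒴 A → 𝒴 X → 𝒴 B)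
    {n : ℕ} {M : C} (hM : Pres S n 𝒴 M) : Pres S n 𝒳 M := by
  induction n generalizing M with
  | zero => exact ⟨M, .nil M⟩
  | succ n ih =>
    obtain ⟨A', hM⟩ := hM
    cases hM with
    | @cons _ _ K I _ x y hI hxy hK =>
      obtain ⟨I', T, i, t, hI', hT, hit⟩ := h.2 I hI
      obtain ⟨N, d, e, k, hk, hde⟩ := exists_conflation_comp hit hxy
      -- It remains to present `N`, an extension of `K` by `I' ∈ 𝒴`.
      suffices hN : Pres S n 𝒴 N by
        obtain ⟨B, hB⟩ := ih hN
        exact ⟨B, .cons _ _ hT hk hB⟩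
      cases hK with
      | nil => exact ⟨N, .nil N⟩
      | @cons _ _ L J _ u v hJ huv hL =>
        obtain ⟨Q, m₁, e₁, m₂, e₂, hQ₁, hQ₂⟩ := exists_pullback hde huv
        exact ⟨A', .cons _ _ (h𝒴 _ _ hQ₁ hI' hJ) hQ₂ hL⟩

theorem isTilting_iff [EnoughProj S] [EnoughInj S] {n : ℕ} (hn : 1 ≤ n) {𝒯 : ObjectProperty C}
    (hadd : IsAdditiveSubcategory 𝒯) (hsummands : ClosedUnderSummands 𝒯)
    (happrox : ∀ A, rightPerp S 𝒯 A → HasRightApprox 𝒯 A) :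
    IsTilting S n 𝒯 ↔ Pres S n 𝒯 = rightPerp S 𝒯 := by
  constructor
  · intro h
    ext A
    refine ⟨fun ⟨A', hA⟩ i T hT => ?_, fun hA => h.generator.pres n hA⟩
    have hpd : projDim S T ≤ n := (le_iSup₂ (f := fun T _ => projDim S T) T hT).trans h.pd_le
    exact extZero_of_triangleSeq h.generator.1 hA hT i (extZero_of_projDim_le hpd i A')
  · intro h
    have hle : ∀ T, 𝒯 T → rightPerp S 𝒯 T := fun T hT => h ▸ pres_of_mem hadd n hT
    have hgen : IsGenerator S 𝒯 (rightPerp S 𝒯) := by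
      refine ⟨hle, fun Y hY => ?_⟩
      obtain ⟨A', hA'⟩ : Pres S n 𝒯 Y := h ▸ hY
      obtain ⟨T₀, f, hT₀, hf⟩ := happrox Y hY
      cases hA' with
      | nil => omega
      | cons x y hX hxy _ =>
        -- A deflation from `𝒯` and an approximation together form a deflation that is still
        -- an approximation.
        obtain ⟨K, k, hk⟩ := exists_conflation_desc hxy f
        have hT := hadd.biprod _ _ hX hT₀
        refine ⟨K, _, k, _, rightPerp_fst hk (hle _ hT) hY fun T' hT' g => ?_, hT, hk⟩
        obtain ⟨l, hl⟩ := hf T' hT' g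
        exact ⟨l ≫ biprod.inr, by simp [hl]⟩
    refine ⟨hadd, hsummands, iSup₂_le fun T hT => projDim_le_of_extZero fun Y => ?_, hgen⟩
    rw [extZero_syzygy_iterate_iff]
    have hY : Pres S n 𝒯 ((cosyzygy S)^[n] Y) := hgen.pres_of_pres (fun _ _ => rightPerp_mid)
      ⟨Y, (triangleSeq_cosyzygy_iterate n Y).mono fun _ hI => hI.rightPerp⟩
    exact (h ▸ hY : rightPerp S 𝒯 _) 0 T hT

/-! ### Duality -/

theorem TriangleSeq.snoc {𝒳 : ObjectProperty C} {n : ℕ} {A A' X L : C}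
    (h : TriangleSeq S 𝒳 n A' A) (x : L ⟶ X) (y : X ⟶ A') (hX : 𝒳 X)
    (hxy : IsConflation S x y) : TriangleSeq S 𝒳 (n + 1) L A := by
  induction h with
  | nil A => exact .cons x y hX hxy (.nil L)
  | cons u v hU huv _ ih => exact .cons u v hU huv (ih y hxy)

theorem TriangleSeq.op {𝒳 : ObjectProperty C} {n : ℕ} {A A' : C} (h : TriangleSeq S 𝒳 n A' A) :
    TriangleSeq S.op 𝒳.op n (Opposite.op A) (Opposite.op A') := by
  induction h with
  | nil A => exact .nil _
  | cons x y hX hxy _ ih => exact ih.snoc y.op x.op hX (isConflation_op_iff.2 hxy)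

theorem TriangleSeq.unop {𝒳 : ObjectProperty C} {n : ℕ} {A A' : Cᵒᵖ}
    (h : TriangleSeq S.op 𝒳.op n A' A) : TriangleSeq S 𝒳 n A.unop A'.unop := by
  induction h with
  | nil A => exact .nil _
  | cons x y hX hxy _ ih => exact ih.snoc y.unop x.unop hX (isConflation_op_iff.1 hxy)

theorem pres_op_iff {𝒯 : ObjectProperty C} {n : ℕ} {A : Cᵒᵖ} :
    Pres S.op n 𝒯.op A ↔ Copres S n 𝒯 A.unop :=
  ⟨fun ⟨A', h⟩ => ⟨A'.unop, h.unop⟩, fun ⟨A', h⟩ => ⟨Opposite.op A', h.op⟩⟩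

theorem isProj_op : IsProj S.op = (IsInj S).op := by
  ext P
  exact isProj_op_iff

theorem projDim_op (A : Cᵒᵖ) : projDim S.op A = injDim S A.unop := by
  have (m : ℕ) : HasProjResolution S.op m A ↔ HasInjResolution S m A.unop := by
    rw [HasProjResolution, isProj_op]
    exact ⟨fun ⟨I, hI, h⟩ => ⟨I.unop, hI, h.unop⟩, fun ⟨I, hI, h⟩ => ⟨Opposite.op I, hI, h.op⟩⟩
  simp only [projDim, injDim, this]

theorem rightPerp_op_iff [EnoughProj S] [EnoughInj S] {𝒯 : ObjectProperty C} {Y : Cᵒᵖ} :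
    rightPerp S.op 𝒯.op Y ↔ leftPerp S 𝒯 Y.unop := by
  have key (i : ℕ) (T : Cᵒᵖ) : ExtZero S.op.E ((syzygy S.op)^[i] T) Y ↔
      ExtZero S.E ((syzygy S)^[i] Y.unop) T.unop := by
    rw [syzygy_op_iterate, extZero_syzygy_iterate_iff]
    rfl
  exact ⟨fun h i T hT => (key i (Opposite.op T)).1 (h i _ hT),
    fun h i T hT => (key i T).2 (h i _ hT)⟩

theorem isTilting_op_iff [EnoughProj S] [EnoughInj S] {𝒯 : ObjectProperty C}
    (hadd : IsAdditiveSubcategory 𝒯) (hsummands : ClosedUnderSummands 𝒯) {n : ℕ} :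
    IsTilting S.op n 𝒯.op ↔ IsCotilting S n 𝒯 := by
  have hdim : (⨆ (T : Cᵒᵖ) (_ : 𝒯.op T), projDim S.op T) = ⨆ (T : C) (_ : 𝒯 T), injDim S T := by
    simp only [projDim_op]
    exact equivToOpposite.symm.iSup_congr fun _ => rfl
  constructor
  · intro h
    refine ⟨hadd, hsummands, hdim ▸ h.pd_le, fun T hT => ?_, fun Y hY => ?_⟩
    · exact rightPerp_op_iff.1 (h.generator.1 (Opposite.op T) hT)
    · obtain ⟨Y', X, x, y, hY', hX, hxy⟩ :=
        h.generator.2 (Opposite.op Y) (rightPerp_op_iff.2 hY)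
      exact ⟨X.unop, Y'.unop, y.unop, x.unop, hX, rightPerp_op_iff.1 hY',
        isConflation_op_iff.1 hxy⟩
  · intro h
    refine ⟨hadd.op, hsummands.op hadd, hdim ▸ h.id_le, fun T hT => ?_, fun Y hY => ?_⟩
    · exact rightPerp_op_iff.2 (h.cogenerator.1 _ hT)
    · obtain ⟨X, Y', x, y, hX, hY', hxy⟩ := h.cogenerator.2 _ (rightPerp_op_iff.1 hY)
      exact ⟨Opposite.op Y', Opposite.op X, y.op, x.op, rightPerp_op_iff.2 hY', hX,
        isConflation_op_iff.2 hxy⟩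

theorem isCotilting_iff [EnoughProj S] [EnoughInj S] {n : ℕ} (hn : 1 ≤ n) {𝒯 : ObjectProperty C}
    (hadd : IsAdditiveSubcategory 𝒯) (hsummands : ClosedUnderSummands 𝒯)
    (happrox : ∀ A, leftPerp S 𝒯 A → HasLeftApprox 𝒯 A) :
    IsCotilting S n 𝒯 ↔ Copres S n 𝒯 = leftPerp S 𝒯 := by
  rw [← isTilting_op_iff hadd hsummands, isTilting_iff hn hadd.op (hsummands.op hadd)
    fun A hA => (happrox _ (rightPerp_op_iff.1 hA)).op]
  constructor
  · intro h
    ext A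
    rw [← pres_op_iff (A := Opposite.op A), h, rightPerp_op_iff]
  · intro h
    ext A
    rw [pres_op_iff, rightPerp_op_iff, h]

end Extri

theorem theorem4p7 {C : Type u} [Category.{v} C] [Preadditive C] [HasZeroObject C] [HasBinaryBiproducts C]
    (S : Extri.ExtriangulatedStructure.{w} C) [Extri.EnoughProj S] [Extri.EnoughInj S]
    (n : ℕ) (hn : 1 ≤ n) :
    (∀ 𝒯 : ObjectProperty C,
      Extri.IsAdditiveSubcategory 𝒯 → Extri.ClosedUnderSummands 𝒯 →
      (∀ A : C, Extri.rightPerp S 𝒯 A → Extri.HasRightApprox 𝒯 A) →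
      (Extri.IsTilting S n 𝒯 ↔ Extri.Pres S n 𝒯 = Extri.rightPerp S 𝒯)) ∧
    (∀ 𝒯 : ObjectProperty C,
      Extri.IsAdditiveSubcategory 𝒯 → Extri.ClosedUnderSummands 𝒯 →
      (∀ A : C, Extri.leftPerp S 𝒯 A → Extri.HasLeftApprox 𝒯 A) →
      (Extri.IsCotilting S n 𝒯 ↔ Extri.Copres S n 𝒯 = Extri.leftPerp S 𝒯)) := by
  exact ⟨fun _ hadd hsummands happrox => Extri.isTilting_iff hn hadd hsummands happrox,
    fun _ hadd hsummands happrox => Extri.isCotilting_iff hn hadd hsummands happrox⟩
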